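/- For every real $\delta>0$ there exist real numbers $\varepsilon=\varepsilon(\delta)>0$ and $c=c(\delta)>0$, depending only on $\delta$, such that for every prime $q$ and every subset $A$ of the field $F=\mathbb{Z}/q\mathbb{Z}$ with $|A|<|F|^{1-\delta}$ one has $$\max(|A+A|,|A\cdot A|)\ \ge\ c\,|A|^{1+\varepsilon},$$ where $A+A=\{a+b : a,b\in A\}$ and $A\cdot A=\{ab : a,b\in A\}$. -/

import Mathlib

open scoped Pointwise

/-!
The sum-product estimate in prime fields. Let `A ⊆ 𝔽_q` avoid `0` and satisfy
`|A + A|, |A * A| ≤ K |A|`. Call `x` good if `x • A` is covered by few translates of `A - A`, where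
"few" means a bound polynomial in `K`. By Ruzsa's covering lemma this follows from
`|A + x • A| ≪ |A|`, and by the Plünnecke-Ruzsa inequality it implies it; consequently good elements
are stable under subtraction, multiplication and inversion, up to a polynomial loss
(`IsCoveredDilate.sub`, `IsCoveredDilate.mul`, `IsCoveredDilate.inv`).

Since `A` has large multiplicative energy, a dilate `X = B / b` of a large subset `B ⊆ A` consists
of good elements (`exists_subset_isCoveredDilate`), and hence so does
`R = (X - X) / (X - X)`. There are two cases.

* `R` is the whole field. Then `|A + x • A| ≪ |A|` for every `x`, so that every pair `A`, `x • A`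
  has additive energy `≫ |A| ^ 3`; but the sum of these energies over `x ≠ 0` is at most
  `|A| ^ 4 + q |A| ^ 2`, which forces `q ≪ |A|` (`card_le_of_forall_card_add_smul_le`).
* `R` is not the whole field. As `0 ∈ R` and `1` generates the additive group, some `r ∈ R` has
  `r - 1 ∉ R`. On the one hand `r - 1` is good; on the other `(x, y) ↦ x + (r - 1) y` is injective
  on `X × X`, so `|X| ^ 2 ≤ |A + (r - 1) • A| ≪ |A|`, which forces `|A| ≪ 1`.

All implied constants being polynomial in `K`, either `|A|` or `q / |A|` is at most a constant times
a power of `K` (`card_le_or_card_zmod_le`). Both fail when `K` is a small power of `|A|` and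
`|A| < q ^ (1 - δ)`.
-/

section Covering

open Finset

variable {F : Type*} [Field F] [DecidableEq F] {A : Finset F} {K L M : ℝ} {x y : F}

/-! ### Dilates covered by few translates of the difference set -/

/-- The dilate of `A` by `x` is contained in the union of at most `L` translates of `A - A`, that
is, in `T + (A - A)` for some `T` of size at most `L`. The inclusion is stated elementwise, and `L`
is real so that the bounds can be polynomials in a real doubling constant. -/
def IsCoveredDilate (A : Finset F) (L : ℝ) (x : F) : Prop :=
  ∃ T : Finset F, (#T : ℝ) ≤ L ∧ ∀ a ∈ A, ∃ t ∈ T, ∃ b ∈ A, ∃ c ∈ A, x * a = t + b - c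

lemma isCoveredDilate_of_card_add_le (hA : A.Nonempty)
    (h : (#(A + x • A) : ℝ) ≤ L * #A) : IsCoveredDilate A L x := by
  rw [add_comm] at h
  obtain ⟨T, -, hT, hsub⟩ := ruzsa_covering_add hA h
  refine ⟨T, hT, fun a ha ↦ ?_⟩
  have := hsub (smul_mem_smul_finset ha)
  simp only [mem_add, mem_sub, smul_eq_mul] at this
  obtain ⟨t, ht, _, ⟨b, hb, c, hc, rfl⟩, h⟩ := this
  exact ⟨t, ht, b, hb, c, hc, by rw [← h]; ring⟩

/-- The Plünnecke-Ruzsa inequality with a real doubling constant. Here `m • A` is the `m`-fold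
iterated sumset, not a dilate. -/
lemma card_nsmul_sub_nsmul_le (hA : A.Nonempty) (hK : (#(A + A) : ℝ) ≤ K * #A) (m n : ℕ) :
    (#(m • A - n • A) : ℝ) ≤ K ^ (m + n) * #A := by
  have hpos : (0 : ℝ) < #A := by exact_mod_cast hA.card_pos
  have h := pluennecke_ruzsa_inequality_nsmul_sub_nsmul_add hA A m n
  have h' : (#(m • A - n • A) : ℝ) ≤ (#(A + A) / #A : ℝ) ^ (m + n) * #A := by
    have := NNRat.cast_le (K := ℝ).2 h
    push_cast at this
    exact this
  refine h'.trans ?_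
  gcongr
  rwa [div_le_iff₀ hpos]

lemma card_add_add_sub_le (hA : A.Nonempty) (hK : (#(A + A) : ℝ) ≤ K * #A) :
    (#(A + A - A) : ℝ) ≤ K ^ 3 * #A := by
  simpa [succ_nsmul] using card_nsmul_sub_nsmul_le hA hK 2 1

lemma card_add_add_add_sub_le (hA : A.Nonempty) (hK : (#(A + A) : ℝ) ≤ K * #A) :
    (#(A + A + A - (A + A)) : ℝ) ≤ K ^ 5 * #A := by
  simpa [succ_nsmul] using card_nsmul_sub_nsmul_le hA hK 3 2

namespace IsCoveredDilate

omit [DecidableEq F] in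
lemma nonneg (hx : IsCoveredDilate A L x) : 0 ≤ L := by
  obtain ⟨T, hT, -⟩ := hx
  exact (Nat.cast_nonneg _).trans hT

omit [DecidableEq F] in
lemma one (hA : A.Nonempty) : IsCoveredDilate A 1 (1 : F) := by
  obtain ⟨t, ht⟩ := hA
  exact ⟨{t}, by simp, fun a ha ↦ ⟨t, by simp, a, ha, t, ht, by ring⟩⟩

/-- The converse of `isCoveredDilate_of_card_add_le`, with a loss of `K ^ 3`. -/
lemma card_add_le (hA : A.Nonempty) (hK : (#(A + A) : ℝ) ≤ K * #A)
    (hx : IsCoveredDilate A L x) : (#(A + x • A) : ℝ) ≤ L * K ^ 3 * #A := by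
  obtain ⟨T, hT, h⟩ := hx
  have hsub : A + x • A ⊆ T + (A + A - A) := by
    intro z hz
    obtain ⟨a, ha, _, hb, rfl⟩ := mem_add.1 hz
    obtain ⟨b, hbA, rfl⟩ := mem_smul_finset.1 hb
    obtain ⟨t, ht, c, hc, d, hd, h⟩ := h b hbA
    rw [smul_eq_mul, h, show a + (t + c - d) = t + (a + c - d) by ring]
    exact add_mem_add ht (sub_mem_sub (add_mem_add ha hc) hd)
  calc (#(A + x • A) : ℝ) ≤ #T * #(A + A - A) := by
        exact_mod_cast (card_le_card hsub).trans Finset.card_add_le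
    _ ≤ L * (K ^ 3 * #A) := by
        gcongr
        · exact (Nat.cast_nonneg _).trans hT
        · exact card_add_add_sub_le hA hK
    _ = _ := by ring

lemma sub (hA : A.Nonempty) (hK : (#(A + A) : ℝ) ≤ K * #A)
    (hx : IsCoveredDilate A L x) (hy : IsCoveredDilate A M y) :
    IsCoveredDilate A (L * M * K ^ 5) (x - y) := by
  have hL := hx.nonneg
  obtain ⟨T, hT, h⟩ := hx
  obtain ⟨U, hU, h'⟩ := hy
  refine isCoveredDilate_of_card_add_le hA ?_
  have hsub : A + (x - y) • A ⊆ (T - U) + (A + A + A - (A + A)) := by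
    intro z hz
    obtain ⟨a, ha, _, hb, rfl⟩ := mem_add.1 hz
    obtain ⟨b, hbA, rfl⟩ := mem_smul_finset.1 hb
    obtain ⟨t, ht, c, hc, d, hd, h⟩ := h b hbA
    obtain ⟨u, hu, c', hc', d', hd', h'⟩ := h' b hbA
    rw [smul_eq_mul, sub_mul, h, h',
      show a + (t + c - d - (u + c' - d')) = t - u + (a + c + d' - (d + c')) by ring]
    exact add_mem_add (sub_mem_sub ht hu)
      (sub_mem_sub (add_mem_add (add_mem_add ha hc) hd') (add_mem_add hd hc'))
  calc (#(A + (x - y) • A) : ℝ) ≤ (#T * #U) * #(A + A + A - (A + A)) := by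
        exact_mod_cast ((card_le_card hsub).trans Finset.card_add_le).trans
          (Nat.mul_le_mul_right _ card_sub_le)
    _ ≤ (L * M) * (K ^ 5 * #A) := by
        gcongr
        · exact mul_nonneg hL ((Nat.cast_nonneg _).trans hU)
        · exact card_add_add_add_sub_le hA hK
    _ = _ := by ring

lemma mul (hA : A.Nonempty) (hK : (#(A + A) : ℝ) ≤ K * #A)
    (hx : IsCoveredDilate A L x) (hy : IsCoveredDilate A M y) :
    IsCoveredDilate A (L ^ 2 * M * K ^ 5) (x * y) := by
  have hL := hx.nonneg
  have hM := hy.nonneg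
  obtain ⟨T, hT, h⟩ := hx
  obtain ⟨U, hU, h'⟩ := hy
  refine isCoveredDilate_of_card_add_le hA ?_
  have hsub : A + (x * y) • A ⊆ (x • U + (T - T)) + (A + A + A - (A + A)) := by
    intro z hz
    obtain ⟨a, ha, _, hb, rfl⟩ := mem_add.1 hz
    obtain ⟨b, hbA, rfl⟩ := mem_smul_finset.1 hb
    obtain ⟨u, hu, c, hc, d, hd, h'⟩ := h' b hbA
    obtain ⟨t, ht, e, he, f, hf, h₁⟩ := h c hc
    obtain ⟨t', ht', e', he', f', hf', h₂⟩ := h d hd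
    rw [smul_eq_mul, mul_assoc, h', mul_sub, mul_add, h₁, h₂,
      show a + (x * u + (t + e - f) - (t' + e' - f')) =
        x • u + (t - t') + (a + e + f' - (f + e')) by rw [smul_eq_mul]; ring]
    exact add_mem_add (add_mem_add (smul_mem_smul_finset hu) (sub_mem_sub ht ht'))
      (sub_mem_sub (add_mem_add (add_mem_add ha he) hf') (add_mem_add hf he'))
  have hcard : #(x • U + (T - T)) ≤ #U * (#T * #T) :=
    Finset.card_add_le.trans (Nat.mul_le_mul card_image_le card_sub_le)
  calc (#(A + (x * y) • A) : ℝ) ≤ (#U * (#T * #T)) * #(A + A + A - (A + A)) := by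
        exact_mod_cast ((card_le_card hsub).trans Finset.card_add_le).trans
          (Nat.mul_le_mul_right _ hcard)
    _ ≤ (M * (L * L)) * (K ^ 5 * #A) := by
        gcongr
        exact card_add_add_add_sub_le hA hK
    _ = _ := by ring

/-- Inversion is harmless because `A + x⁻¹ • A` is a dilate of `A + x • A`. -/
lemma inv (hA : A.Nonempty) (hK : (#(A + A) : ℝ) ≤ K * #A) (hx0 : x ≠ 0)
    (hx : IsCoveredDilate A L x) : IsCoveredDilate A (L * K ^ 3) x⁻¹ := by
  refine isCoveredDilate_of_card_add_le hA ((hx.card_add_le hA hK).trans' ?_)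
  have hsub : A + x⁻¹ • A ⊆ (A + x • A).image (x⁻¹ * ·) := by
    intro z hz
    obtain ⟨a, ha, _, hb, rfl⟩ := mem_add.1 hz
    obtain ⟨b, hbA, rfl⟩ := mem_smul_finset.1 hb
    refine mem_image.2 ⟨b + x • a, add_mem_add hbA (smul_mem_smul_finset ha), ?_⟩
    simp only [smul_eq_mul]
    field_simp
    ring
  exact_mod_cast (card_le_card hsub).trans card_image_le

end IsCoveredDilate

/-! ### Many covered dilates from multiplicative energy -/

/-- A set with small product set has many popular ratios `a / b` with a common denominator: those
for which `a • A ∩ b • A` is large. Ruzsa's triangle inequality through this intersection bounds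
`A + (a / b) • A`. -/
lemma exists_subset_isCoveredDilate (h0 : 0 ∉ A) (hA : A.Nonempty)
    (hK : (#(A + A) : ℝ) ≤ K * #A) (hK' : (#(A * A) : ℝ) ≤ K * #A) (hKpos : 0 < K) :
    ∃ b ∈ A, ∃ B ⊆ A, (#A : ℝ) ≤ 2 * K * #B ∧
      ∀ a ∈ B, IsCoveredDilate A (2 * K ^ 3) (a / b) := by
  have hpos : (0 : ℝ) < #A := by exact_mod_cast hA.card_pos
  have hne : ∀ a ∈ A, a ≠ 0 := fun a ha h ↦ h0 (h ▸ ha)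
  have henergy : mulEnergy A A ≤ ∑ b ∈ A, ∑ a ∈ A, #(a • A ∩ b • A) := by
    rw [mulEnergy, ← sum_product', ← card_sigma]
    refine card_le_card_of_injOn
      (fun z ↦ ⟨(z.1.2, z.1.1), z.1.1 * z.2.1⟩) ?_ ?_
    · rintro ⟨⟨a, b⟩, c, d⟩ h
      simp only [coe_filter, mem_product, Set.mem_ofPred_eq] at h
      obtain ⟨⟨⟨ha, hb⟩, hc, hd⟩, h⟩ := h
      simp only [coe_sigma, Set.mem_sigma_iff, mem_coe, mem_product, mem_inter]
      exact ⟨⟨hb, ha⟩, smul_mem_smul_finset hc, h ▸ smul_mem_smul_finset hd⟩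
    · rintro ⟨⟨a, b⟩, c, d⟩ h ⟨⟨a', b'⟩, c', d'⟩ h' heq
      simp only [coe_filter, mem_product, Set.mem_ofPred_eq] at h h'
      simp only [Sigma.mk.injEq, Prod.mk.injEq, heq_eq_eq] at heq
      obtain ⟨⟨rfl, rfl⟩, heq⟩ := heq
      have hc := mul_left_cancel₀ (hne _ h.1.1.1) heq
      have hd : d = d' := mul_left_cancel₀ (hne _ h.1.1.2) (by rw [← h.2, ← h'.2, heq])
      rw [hc, hd]
  have hlow : (#A : ℝ) ^ 3 ≤ K * ∑ b ∈ A, ∑ a ∈ A, (#(a • A ∩ b • A) : ℝ) := by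
    have h1 : (#A : ℝ) ^ 2 * #A ^ 2 ≤ #(A * A) * mulEnergy A A := by
      exact_mod_cast le_card_mul_mul_mulEnergy A A
    have h2 : (mulEnergy A A : ℝ) ≤ ∑ b ∈ A, ∑ a ∈ A, (#(a • A ∩ b • A) : ℝ) := by
      exact_mod_cast henergy
    refine le_of_mul_le_mul_right ?_ hpos
    calc (#A : ℝ) ^ 3 * #A = #A ^ 2 * #A ^ 2 := by ring
      _ ≤ _ := h1
      _ ≤ (K * #A) * ∑ b ∈ A, ∑ a ∈ A, (#(a • A ∩ b • A) : ℝ) := by gcongr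
      _ = _ := by ring
  -- Averaging over the common denominator.
  obtain ⟨b, hb, hbsum⟩ : ∃ b ∈ A, (#A : ℝ) ^ 2 / K ≤ ∑ a ∈ A, (#(a • A ∩ b • A) : ℝ) := by
    refine exists_le_of_sum_le hA ?_
    rw [sum_const, nsmul_eq_mul, mul_div_assoc', div_le_iff₀' hKpos]
    linarith
  refine ⟨b, hb, {a ∈ A | (#A : ℝ) / (2 * K) ≤ #(a • A ∩ b • A)}, filter_subset _ _, ?_, ?_⟩
  -- The terms below `#A / (2 * K)` account for at most half of the sum, and no term exceeds `#A`.
  · have hle : ∑ a ∈ A, (#(a • A ∩ b • A) : ℝ) ≤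
        ∑ a ∈ A, ((if (#A : ℝ) / (2 * K) ≤ #(a • A ∩ b • A) then (#A : ℝ) else 0)
          + #A / (2 * K)) := by
      refine sum_le_sum fun a _ ↦ ?_
      split_ifs with h
      · have : #(a • A ∩ b • A) ≤ #A := (card_le_card inter_subset_left).trans card_image_le
        have : (#(a • A ∩ b • A) : ℝ) ≤ #A := by exact_mod_cast this
        have : 0 ≤ (#A : ℝ) / (2 * K) := by positivity
        linarith
      · linarith
    rw [sum_add_distrib, ← sum_filter, sum_const, sum_const, nsmul_eq_mul, nsmul_eq_mul] at hle
    have h := hbsum.trans hle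
    have e : (#A : ℝ) ^ 2 / K = 2 * (#A * (#A / (2 * K))) := by field_simp
    have h' : (#A : ℝ) * (#A / (2 * K)) ≤
        #{a ∈ A | (#A : ℝ) / (2 * K) ≤ #(a • A ∩ b • A)} * #A := by linarith
    rw [mul_comm] at h'
    have := le_of_mul_le_mul_right h' hpos
    rwa [div_le_iff₀' (by positivity)] at this
  · intro a ha
    obtain ⟨ha, hint⟩ := mem_filter.1 ha
    have hb0 := hne b hb
    refine isCoveredDilate_of_card_add_le hA ?_
    set I := a • A ∩ b • A with hI
    have hsub : A + (a / b) • A ⊆ (b • A + a • A).image (b⁻¹ * ·) := by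
      intro z hz
      obtain ⟨c, hc, _, hd, rfl⟩ := mem_add.1 hz
      obtain ⟨d, hdA, rfl⟩ := mem_smul_finset.1 hd
      refine mem_image.2 ⟨b • c + a • d,
        add_mem_add (smul_mem_smul_finset hc) (smul_mem_smul_finset hdA), ?_⟩
      simp only [smul_eq_mul]
      field_simp
    have hdil : ∀ c : F, #(c • A + c • A) ≤ #(A + A) := fun c ↦ by
      have : c • A + c • A ⊆ (A + A).image (c * ·) := by
        intro z hz
        obtain ⟨_, hc, _, hd, rfl⟩ := mem_add.1 hz
        obtain ⟨d, hdA, rfl⟩ := mem_smul_finset.1 hd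
        obtain ⟨e, heA, rfl⟩ := mem_smul_finset.1 hc
        exact mem_image.2 ⟨e + d, add_mem_add heA hdA, by simp [mul_add]⟩
      exact (card_le_card this).trans card_image_le
    have h1 : #(A + (a / b) • A) * #I ≤ #(A + A) * #(A + A) := calc
      _ ≤ #(b • A + a • A) * #I :=
        Nat.mul_le_mul_right _ ((card_le_card hsub).trans card_image_le)
      _ ≤ #(b • A + I) * #(I + a • A) := ruzsa_triangle_inequality_add_add_add _ _ _
      _ ≤ _ := Nat.mul_le_mul
        ((card_le_card (add_subset_add_left inter_subset_right)).trans (hdil b))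
        ((card_le_card (add_subset_add_right inter_subset_left)).trans (hdil a))
    have h2 : (#(A + (a / b) • A) : ℝ) * #I ≤ #(A + A) * #(A + A) := by exact_mod_cast h1
    have hpos' : 0 < (#A : ℝ) / (2 * K) := by positivity
    refine le_of_mul_le_mul_right ?_ hpos'
    calc (#(A + (a / b) • A) : ℝ) * (#A / (2 * K)) ≤ #(A + (a / b) • A) * #I := by gcongr
      _ ≤ _ := h2
      _ ≤ (K * #A) * (K * #A) := by gcongr
      _ = _ := by field_simp

/-! ### Additive energy of a set and its dilates -/

lemma card_filter_add_mul_eq_le [Fintype F] (a b c d : F) :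
    #{x : F | x ≠ 0 ∧ a + x * c = b + x * d} ≤
      1 + if a = b ∧ c = d then #((univ : Finset F).erase 0) else 0 := by
  split_ifs with h
  · refine le_add_left (card_le_card fun x hx ↦ ?_)
    simpa using (mem_filter.1 hx).2.1
  · rw [add_zero, card_le_one]
    simp only [mem_filter, mem_univ, true_and]
    rintro x ⟨-, hx⟩ y ⟨-, hy⟩
    have hcd : c - d ≠ 0 := fun hcd ↦ by
      have : c = d := sub_eq_zero.1 hcd
      subst this
      exact h ⟨add_right_cancel hx, rfl⟩
    exact mul_right_cancel₀ hcd (by linear_combination hx - hy)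

/-- A quadruple with `a + x * c = b + x * d` determines `x`, unless `a = b` and `c = d`. -/
lemma sum_addEnergy_smul_le [Fintype F] (A : Finset F) :
    ∑ x ∈ univ.erase (0 : F), addEnergy A (x • A) ≤
      #A ^ 4 + #((univ : Finset F).erase 0) * #A ^ 2 := by
  have h1 : ∀ x ∈ univ.erase (0 : F), addEnergy A (x • A) ≤
      #{z ∈ (A ×ˢ A) ×ˢ A ×ˢ A | x ≠ 0 ∧ z.1.1 + x * z.2.1 = z.1.2 + x * z.2.2} := by
    intro x hx
    have hx0 : x ≠ 0 := ne_of_mem_erase hx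
    refine card_le_card_of_surjOn (fun z ↦ (z.1, x • z.2.1, x • z.2.2)) ?_
    rintro ⟨⟨a, b⟩, u, v⟩ hz
    simp only [coe_filter, mem_product, Set.mem_ofPred_eq] at hz
    obtain ⟨⟨⟨ha, hb⟩, hu, hv⟩, h⟩ := hz
    obtain ⟨c, hc, rfl⟩ := mem_smul_finset.1 hu
    obtain ⟨d, hd, rfl⟩ := mem_smul_finset.1 hv
    exact ⟨((a, b), c, d), by simpa [ha, hb, hc, hd, hx0] using h, rfl⟩
  calc _ ≤ ∑ x : F, #{z ∈ (A ×ˢ A) ×ˢ A ×ˢ A |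
          x ≠ 0 ∧ z.1.1 + x * z.2.1 = z.1.2 + x * z.2.2} :=
        (sum_le_sum h1).trans (sum_le_sum_of_subset (subset_univ _))
    _ = ∑ z ∈ (A ×ˢ A) ×ˢ A ×ˢ A,
          #{x : F | x ≠ 0 ∧ z.1.1 + x * z.2.1 = z.1.2 + x * z.2.2} := by
        simp only [card_filter]
        exact sum_comm
    _ ≤ ∑ z ∈ (A ×ˢ A) ×ˢ A ×ˢ A, (1 + if z.1.1 = z.1.2 ∧ z.2.1 = z.2.2 then
          #((univ : Finset F).erase 0) else 0) :=
        sum_le_sum fun z _ ↦ card_filter_add_mul_eq_le _ _ _ _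
    _ ≤ _ := by
        rw [sum_add_distrib, ← sum_filter, sum_const, sum_const, smul_eq_mul, smul_eq_mul,
          mul_one, mul_comm]
        refine add_le_add (by simp only [card_product]; exact le_of_eq (by ring))
          (Nat.mul_le_mul_left _ ?_)
        rw [sq, ← card_product]
        refine card_le_card_of_injOn (fun z ↦ (z.1.1, z.2.1)) ?_ ?_
        · rintro ⟨⟨a, b⟩, c, d⟩ h
          simp only [coe_filter, mem_product, Set.mem_ofPred_eq] at h
          simp [h.1.1.1, h.1.2.1]
        · rintro ⟨⟨a, b⟩, c, d⟩ h ⟨⟨a', b'⟩, c', d'⟩ h' heq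
          simp only [coe_filter, mem_product, Set.mem_ofPred_eq] at h h'
          simp only [Prod.mk.injEq] at heq
          rw [← h.2.1, ← h.2.2, ← h'.2.1, ← h'.2.2, heq.1, heq.2]

/-- If no dilate of `A` expands, then `A` has positive proportion in the field: small sumsets make
all the energies of `A` and `x • A` large, against `sum_addEnergy_smul_le`. -/
lemma card_le_of_forall_card_add_smul_le [Fintype F] (hA : A.Nonempty)
    (hM : ∀ x : F, (#(A + x • A) : ℝ) ≤ M * #A) (hAM : 2 * M ≤ #A) :
    (Fintype.card F : ℝ) ≤ 2 * M * #A + 1 := by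
  have hpos : (0 : ℝ) < #A := by exact_mod_cast hA.card_pos
  have hq : (Fintype.card F : ℝ) = #((univ : Finset F).erase 0) + 1 := by
    exact_mod_cast (card_erase_add_one (mem_univ (0 : F))).symm
  set Q : ℝ := (#((univ : Finset F).erase 0) : ℝ) with hQ
  have hlow : ∀ x ∈ univ.erase (0 : F), (#A : ℝ) ^ 3 ≤ M * addEnergy A (x • A) := by
    intro x hx
    have hx0 : x ≠ 0 := ne_of_mem_erase hx
    have hcard : #(x • A) = #A := card_image_of_injective _ (mul_right_injective₀ hx0)
    have h := le_card_add_mul_addEnergy A (x • A)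
    rw [hcard] at h
    have h' : (#A : ℝ) ^ 2 * #A ^ 2 ≤ #(A + x • A) * addEnergy A (x • A) := by exact_mod_cast h
    refine le_of_mul_le_mul_right ?_ hpos
    calc (#A : ℝ) ^ 3 * #A = #A ^ 2 * #A ^ 2 := by ring
      _ ≤ _ := h'
      _ ≤ (M * #A) * addEnergy A (x • A) := by gcongr; exact hM x
      _ = _ := by ring
  have hM0 : 0 ≤ M := by
    have := (Nat.cast_nonneg _).trans (hM 0)
    exact nonneg_of_mul_nonneg_left this hpos
  have hsum := sum_le_sum hlow
  rw [sum_const, nsmul_eq_mul, ← mul_sum, ← hQ] at hsum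
  have hupp : (∑ x ∈ univ.erase (0 : F), (addEnergy A (x • A) : ℝ)) ≤ #A ^ 4 + Q * #A ^ 2 := by
    rw [hQ]
    exact_mod_cast sum_addEnergy_smul_le A
  have h1 : Q * (#A : ℝ) ^ 3 ≤ M * (#A ^ 4 + Q * #A ^ 2) :=
    hsum.trans (mul_le_mul_of_nonneg_left hupp hM0)
  -- The diagonal contribution is absorbed because `2 * M ≤ #A`.
  have h2 : M * Q * (#A : ℝ) ^ 2 * 2 ≤ Q * #A ^ 3 := by
    have : (0 : ℝ) ≤ Q * #A ^ 2 := by positivity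
    nlinarith
  have h3 : Q * (#A : ℝ) ^ 3 ≤ (2 * M * #A) * #A ^ 3 := by linarith
  have h4 := le_of_mul_le_mul_right h3 (by positivity)
  linarith

/-! ### Quotients of differences -/

/-- The set `(X - X) / (X - X)` of quotients of differences with nonzero denominator; it is empty if
`X` has at most one element. -/
def differenceQuotients (X : Finset F) : Set F :=
  {r | ∃ a ∈ X, ∃ b ∈ X, ∃ c ∈ X, ∃ d ∈ X, c ≠ d ∧ r = (c - d)⁻¹ * (a - b)}

lemma IsCoveredDilate.of_mem_differenceQuotients {X : Finset F} (hA : A.Nonempty)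
    (hK : (#(A + A) : ℝ) ≤ K * #A) (hX : ∀ x ∈ X, IsCoveredDilate A L x)
    (hy : y ∈ differenceQuotients X) : IsCoveredDilate A (L ^ 6 * K ^ 26) y := by
  obtain ⟨a, ha, b, hb, c, hc, d, hd, hcd, rfl⟩ := hy
  have h1 := (((hX c hc).sub hA hK (hX d hd)).inv hA hK (sub_ne_zero.2 hcd)).mul hA hK
    ((hX a ha).sub hA hK (hX b hb))
  convert h1 using 1
  ring

/-- Outside the quotient set, `(a, b) ↦ a + x * b` is injective on `X × X`. -/
lemma card_sq_le_of_notMem_differenceQuotients {X : Finset F}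
    (hx : x ∉ differenceQuotients X) : #X ^ 2 ≤ #(X + x • X) := by
  rw [sq, ← card_product]
  refine card_le_card_of_injOn (fun z ↦ z.1 + x • z.2) ?_ ?_
  · rintro ⟨a, b⟩ h
    obtain ⟨ha, hb⟩ := mem_product.1 h
    exact add_mem_add ha (smul_mem_smul_finset hb)
  · rintro ⟨a, b⟩ h ⟨c, d⟩ h' heq
    obtain ⟨ha, hb⟩ := mem_product.1 h
    obtain ⟨hc, hd⟩ := mem_product.1 h'
    simp only [smul_eq_mul] at heq ha hb hc hd
    have hbd : b = d := by
      by_contra hbd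
      refine hx ⟨c, hc, a, ha, b, hb, d, hd, hbd, ?_⟩
      rw [eq_inv_mul_iff_mul_eq₀ (sub_ne_zero.2 hbd)]
      linear_combination heq
    subst hbd
    rw [add_right_cancel heq]

end Covering

/-! ### The sum-product estimate in prime fields -/

section Prime

open Finset

variable {q : ℕ} [Fact q.Prime]

lemma eq_univ_or_exists_sub_one_notMem {R : Set (ZMod q)} (h0 : 0 ∈ R) :
    R = Set.univ ∨ ∃ r ∈ R, r - 1 ∉ R := by
  by_contra! h
  obtain ⟨hne, h⟩ := h
  refine hne (Set.eq_univ_of_forall fun x ↦ ?_)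
  have hk : ∀ k : ℕ, -(k : ZMod q) ∈ R := fun k ↦ by
    induction k with
    | zero => simpa using h0
    | succ k ih => simpa [sub_eq_add_neg, add_comm] using h _ ih
  obtain ⟨k, hx⟩ := ZMod.natCast_zmod_surjective (-x)
  simpa [hx] using hk k

/-- The sum-product dichotomy: small doubling, both additive and multiplicative, is possible only for
sets which are bounded or occupy a large proportion of the field, in terms of `K`. -/
lemma card_le_or_card_zmod_le {A : Finset (ZMod q)} {K : ℝ} (h0 : 0 ∉ A) (hA : A.Nonempty)
    (hK : (#(A + A) : ℝ) ≤ K * #A) (hK' : (#(A * A) : ℝ) ≤ K * #A) (hK1 : 1 ≤ K) :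
    (#A : ℝ) ≤ 256 * K ^ 54 ∨ (Fintype.card (ZMod q) : ℝ) ≤ 256 * K ^ 54 * #A := by
  have hK0 : 0 < K := by linarith
  have hpos : (1 : ℝ) ≤ #A := by exact_mod_cast hA.card_pos
  have hpow : ∀ {m : ℕ}, m ≤ 54 → K ^ m ≤ K ^ 54 := fun h ↦ pow_le_pow_right₀ hK1 h
  obtain ⟨b, hb, B, hBA, hcard, hB⟩ := exists_subset_isCoveredDilate h0 hA hK hK' hK0
  have hb0 : b ≠ 0 := fun h ↦ h0 (h ▸ hb)
  rcases le_or_gt (#B) 1 with hB1 | hB1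
  · left
    have : (#B : ℝ) ≤ 1 := by exact_mod_cast hB1
    have := hpow (m := 1) (by norm_num)
    nlinarith
  set X : Finset (ZMod q) := B.image (· / b) with hXdef
  have hX : ∀ x ∈ X, IsCoveredDilate A (2 * K ^ 3) x := by
    intro x hx
    obtain ⟨a, ha, rfl⟩ := mem_image.1 hx
    exact hB a ha
  have hXcard : #X = #B := card_image_of_injective _ fun _ _ h ↦ (div_left_inj' hb0).1 h
  have hzero : (0 : ZMod q) ∈ differenceQuotients X := by
    obtain ⟨c, hc, d, hd, hcd⟩ := one_lt_card.1 (hXcard ▸ hB1)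
    exact ⟨c, hc, c, hc, c, hc, d, hd, hcd, by simp⟩
  rcases eq_univ_or_exists_sub_one_notMem hzero with huniv | ⟨r, hr, hr'⟩
  · have hM : ∀ x : ZMod q, (#(A + x • A) : ℝ) ≤ (64 * K ^ 47) * #A := by
      intro x
      have h := (IsCoveredDilate.of_mem_differenceQuotients hA hK hX
        (huniv ▸ Set.mem_univ x)).card_add_le hA hK
      convert h using 2
      ring
    have h47 := hpow (m := 47) (by norm_num)
    rcases le_or_gt (2 * (64 * K ^ 47)) (#A : ℝ) with hAM | hAM
    · right
      have h := card_le_of_forall_card_add_smul_le hA hM hAM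
      have h1 : 1 ≤ K ^ 54 := one_le_pow₀ hK1
      nlinarith
    · left
      have : 0 < K ^ 54 := by positivity
      linarith
  · left
    have hcov := (IsCoveredDilate.of_mem_differenceQuotients hA hK hX hr).sub hA hK
      (IsCoveredDilate.one hA)
    have hsum := hcov.card_add_le hA hK
    have hsub : X + (r - 1) • X ⊆ (A + (r - 1) • A).image (· / b) := by
      intro z hz
      obtain ⟨_, hu, _, hv, rfl⟩ := mem_add.1 hz
      obtain ⟨v, hvX, rfl⟩ := mem_smul_finset.1 hv
      obtain ⟨c, hc, rfl⟩ := mem_image.1 hu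
      obtain ⟨d, hd, rfl⟩ := mem_image.1 hvX
      refine mem_image.2 ⟨c + (r - 1) • d,
        add_mem_add (hBA hc) (smul_mem_smul_finset (hBA hd)), ?_⟩
      simp only [smul_eq_mul]
      ring
    have hsq : #B ^ 2 ≤ #(A + (r - 1) • A) := by
      rw [← hXcard]
      exact (card_sq_le_of_notMem_differenceQuotients hr').trans
        ((card_le_card hsub).trans card_image_le)
    have hsq' : (#B : ℝ) ^ 2 ≤ #(A + (r - 1) • A) := by exact_mod_cast hsq
    refine le_of_mul_le_mul_right ?_ (by linarith : (0 : ℝ) < #A)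
    calc (#A : ℝ) * #A ≤ (2 * K * #B) * (2 * K * #B) := by gcongr
      _ = 4 * K ^ 2 * #B ^ 2 := by ring
      _ ≤ 4 * K ^ 2 * ((2 * K ^ 3) ^ 6 * K ^ 26 * 1 * K ^ 5 * K ^ 3 * #A) := by
        gcongr
        exact hsq'.trans hsum
      _ = 256 * K ^ 54 * #A := by ring

end Prime

theorem corollary1 (δ : ℝ) (hδ : 0 < δ) :
    ∃ ε : ℝ, 0 < ε ∧ ∃ c : ℝ, 0 < c ∧
      ∀ (q : ℕ) [Fact q.Prime] (A : Finset (ZMod q)),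
        (A.card : ℝ) < (Fintype.card (ZMod q) : ℝ) ^ (1 - δ) →
          c * (A.card : ℝ) ^ (1 + ε) ≤ max ((A + A).card : ℝ) ((A * A).card : ℝ) := by
  have hmin : 0 < min δ 1 := lt_min hδ one_pos
  refine ⟨min δ 1 / 54, by positivity, 1 / 4, by norm_num, fun q _ A hlt ↦ ?_⟩
  set ε : ℝ := min δ 1 / 54 with hε
  have hε0 : 0 < ε := by positivity
  have hεδ : 54 * ε ≤ δ := by rw [hε]; linarith [min_le_left δ 1]
  have hε1 : 54 * ε ≤ 1 := by rw [hε]; linarith [min_le_right δ 1]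
  rcases A.eq_empty_or_nonempty with rfl | hA
  · simp [Real.zero_rpow (by positivity : (1 : ℝ) + ε ≠ 0)]
  rcases eq_or_lt_of_le (Nat.one_le_iff_ne_zero.2 hA.card_pos.ne') with h1 | h2
  · have : 1 ≤ (A + A).card := (hA.add hA).card_pos
    rw [← h1]
    refine le_max_of_le_left ?_
    have : (1 : ℝ) ≤ (A + A).card := by exact_mod_cast this
    norm_num
    linarith
  by_contra! hmax
  -- As `n ≥ 2`, removing `0` keeps at least half of `A`, so the sum set and the product set of `B`
  -- are smaller than `n ^ (1 + ε) / 4 ≤ (n ^ ε / 2) * #B`. The bound of `card_le_or_card_zmod_le`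
  -- involves the 54th power of `n ^ ε / 2`, which is at most `n ^ min δ 1 / 2 ^ 54`.
  set n : ℝ := (A.card : ℝ) with hn
  have hn2 : 2 ≤ n := by
    rw [hn]
    exact_mod_cast h2
  set B := A.erase 0 with hB
  have hBA : B ⊆ A := Finset.erase_subset _ _
  have hcard : n / 2 ≤ (B.card : ℝ) := by
    have h : A.card ≤ B.card + 1 := by
      have := Finset.pred_card_le_card_erase (s := A) (a := 0)
      rw [← hB] at this
      omega
    have h : n ≤ B.card + 1 := by
      rw [hn]
      exact_mod_cast h
    linarith
  have hBpos : (0 : ℝ) < B.card := by linarith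
  have hBne : B.Nonempty := Finset.card_pos.1 (by exact_mod_cast hBpos)
  have hBn : (B.card : ℝ) ≤ n := by
    rw [hn]
    exact_mod_cast Finset.card_le_card hBA
  have hadd : ((B + B).card : ℝ) ≤ n ^ ε / 2 * B.card := by
    have h : ((B + B).card : ℝ) ≤ (A + A).card := by
      exact_mod_cast Finset.card_le_card (Finset.add_subset_add hBA hBA)
    have h' := (le_max_left _ _).trans_lt hmax
    rw [Real.rpow_add (by linarith), Real.rpow_one] at h'
    have : n ^ ε / 2 * (n / 2) ≤ n ^ ε / 2 * B.card := by gcongr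
    linarith
  have hmul : ((B * B).card : ℝ) ≤ n ^ ε / 2 * B.card := by
    have h : ((B * B).card : ℝ) ≤ (A * A).card := by
      exact_mod_cast Finset.card_le_card (Finset.mul_subset_mul hBA hBA)
    have h' := (le_max_right _ _).trans_lt hmax
    rw [Real.rpow_add (by linarith), Real.rpow_one] at h'
    have : n ^ ε / 2 * (n / 2) ≤ n ^ ε / 2 * B.card := by gcongr
    linarith
  have hK1 : 1 ≤ n ^ ε / 2 := by
    have h : (B.card : ℝ) ≤ (B + B).card := by
      exact_mod_cast Finset.card_le_card_add_left hBne
    exact le_of_mul_le_mul_right (by linarith) hBpos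
  have hpow : 256 * (n ^ ε / 2) ^ 54 = n ^ (54 * ε) / 2 ^ 46 := by
    rw [div_pow, ← Real.rpow_natCast (n ^ ε), ← Real.rpow_mul (by linarith), mul_comm ε]
    norm_num
    ring
  have hn0 : 0 < n := by linarith
  have hnpos : 0 < n ^ (54 * ε) := Real.rpow_pos_of_pos hn0 _
  rcases card_le_or_card_zmod_le (Finset.notMem_erase 0 A) hBne hadd hmul hK1 with h | h
  · rw [hpow] at h
    have : n ^ (54 * ε) ≤ n := by
      simpa using Real.rpow_le_rpow_of_exponent_le (by linarith : 1 ≤ n) hε1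
    linarith
  · rw [hpow] at h
    set Q : ℝ := (Fintype.card (ZMod q) : ℝ) with hQ
    have hQ1 : 1 ≤ Q := by
      rw [hQ]
      exact_mod_cast Fintype.card_pos
    have h1 : Q < n ^ (1 + 54 * ε) := by
      rw [Real.rpow_add hn0, Real.rpow_one]
      have : n ^ (54 * ε) * B.card ≤ n ^ (54 * ε) * n := by gcongr
      have : 0 < n ^ (54 * ε) * n := by positivity
      linarith
    have h2 : n ^ (1 + 54 * ε) ≤ Q ^ ((1 - δ) * (1 + 54 * ε)) := by
      rw [Real.rpow_mul (by linarith)]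
      exact Real.rpow_le_rpow hn0.le hlt.le (by positivity)
    have h3 : Q ^ ((1 - δ) * (1 + 54 * ε)) ≤ Q := by
      have : (1 - δ) * (1 + 54 * ε) ≤ 1 := by nlinarith
      simpa using Real.rpow_le_rpow_of_exponent_le hQ1 this
    linarith
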